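/- Let $p(z)=z^d+p_{d-1}z^{d-1}+\cdots+p_1z$ be a monic real polynomial of degree $d\ge 2$ with $p(0)=0$ and $p'(0)=p_1=\lambda>1$, and put $\rho=\log d/\log\lambda$. Let $f$ be the entire solution of the Poincaré equation $f(\lambda z)=p(f(z))$ with $f(0)=0$ and $f'(0)=1$. Let $\mathcal J(p)$ be the Julia set of $p$, i.e. the complement in the Riemann sphere of the set of points that have an open neighbourhood on which the iterates of $p$ are equicontinuous in the chordal metric. Suppose that $\mathcal J(p)\subset\mathbb R$ and that $p_i\ge 0$ for all $i\ge 2$. Then $\mathcal J(p)\subset(-\infty,0]$, and there is a function $F$, holomorphic and periodic of period $1$ in the strip $|\Im w|<\pi/\log\lambda$, such that for every $\varepsilon>0$: (i) $f(z)\sim\exp\left(z^\rho F\left(\frac{\log z}{\log\lambda}\right)\right)$ as $z\to\infty$, uniformly in the sector $|\operatorname{Arg} z|\le\pi-\varepsilon$; (ii) there are constants $A,B>0$ (which may depend on $\varepsilon$) such that $$A\le \Re\left(e^{i\rho \operatorname{Arg} z}F\left(\frac{\log z}{\log\lambda}\right)\right)\le B$$ for all $z\ne0$ with $|\operatorname{Arg}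 z|\le\pi-\varepsilon$. Here $\operatorname{Arg}$, $\log z$ and $z^\rho$ are the principal branches. -/

import Mathlib

open Filter Topology Asymptotics
open scoped OnePoint

namespace PolyDynamics

/-- The chordal metric on the Riemann sphere `OnePoint ℂ`. -/
noncomputable def chordalDist : OnePoint ℂ → OnePoint ℂ → ℝ
  | OnePoint.some z, OnePoint.some w =>
      2 * ‖z - w‖ / (Real.sqrt (1 + ‖z‖ ^ 2) * Real.sqrt (1 + ‖w‖ ^ 2))
  | OnePoint.some z, OnePoint.infty => 2 / Real.sqrt (1 + ‖z‖ ^ 2)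
  | OnePoint.infty, OnePoint.some w => 2 / Real.sqrt (1 + ‖w‖ ^ 2)
  | OnePoint.infty, OnePoint.infty => 0

/-- The real polynomial `p`, acting on the Riemann sphere and fixing `∞`
(the continuous extension of `z ↦ p z` when `p` is not constant). -/
noncomputable def sphereMap (p : Polynomial ℝ) : OnePoint ℂ → OnePoint ℂ :=
  OnePoint.map fun z : ℂ => Polynomial.aeval z p

/-- The Fatou set: the points of the sphere with an open neighbourhood on which the sequence of
iterates of `p` is equicontinuous with respect to the chordal metric. -/
def fatouSet (p : Polynomial ℝ) : Set (OnePoint ℂ) :=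
  {ζ | ∃ U : Set (OnePoint ℂ), IsOpen U ∧ ζ ∈ U ∧
    ∀ x ∈ U, ∀ ε > (0 : ℝ), ∃ δ > (0 : ℝ), ∀ y ∈ U, chordalDist x y < δ →
      ∀ n : ℕ, chordalDist ((sphereMap p)^[n] x) ((sphereMap p)^[n] y) < ε}

/-- The Julia set, the complement of the Fatou set in the Riemann sphere. -/
def juliaSet (p : Polynomial ℝ) : Set (OnePoint ℂ) := (fatouSet p)ᶜ

end PolyDynamics

namespace PolyDynamics

open Polynomial Bornology

/-! Let K be the filled Julia set. Points off K are Fatou, and points of K that are limits of its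
complement are Julia. A point of the compact K with maximal |Im| is of the latter kind, hence real;
so K is real. Nonnegative coefficients give p(x) ≥ λx for x ≥ 0, so positive points escape and K
lies in (-∞,0].

If f(z) ∈ K, then f(z/λⁿ) ∈ K for every n, and λⁿ f(z/λⁿ) → z forces z ∈ (-∞,0]
(`poincare_notMem_filledJuliaSet`). Hence f(exp w) has no zeros in |Im w| < π, and it tends to ∞ to
the right, uniformly on smaller strips (`exists_le_norm_poincare_exp`). With c = log λ, its
logarithm l satisfies l(w+c) = d·l(w) + o(1), because p(u)/u^d → 1 (`exists_log_poincare_exp`).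
Summing the errors with weights d^{-(n+1)} corrects l to an exact solution H of H(w+c) = d·H(w) with
H - l → 0 (`exists_homogeneous_of_almost`).

Then F(w) = H(cw)·exp(-ρcw) is periodic, and (i) is exp(l - H) → 1. Since Re l = log|f ∘ exp| → ∞,
homogeneity makes Re H positive everywhere; (ii) follows by periodicity and compactness
(`exists_bounds_of_homogeneous`). -/

/-- The action of a real polynomial on the complex plane. -/
noncomputable def planeMap (p : ℝ[X]) (z : ℂ) : ℂ := aeval z p

/-- The filled Julia set: the points of the plane with a bounded orbit. -/
def filledJuliaSet (p : ℝ[X]) : Set ℂ := {z | ∃ M : ℝ, ∀ n : ℕ, ‖(planeMap p)^[n] z‖ ≤ M}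

lemma continuous_planeMap (p : ℝ[X]) : Continuous (planeMap p) := p.continuous_aeval

lemma sphereMap_iterate_coe (p : ℝ[X]) (n : ℕ) (z : ℂ) :
    (sphereMap p)^[n] (z : OnePoint ℂ) = (((planeMap p)^[n] z : ℂ) : OnePoint ℂ) :=
  ((Function.Semiconj.iterate_right
    (show Function.Semiconj ((↑) : ℂ → OnePoint ℂ) (planeMap p) (sphereMap p) from
      fun _ => rfl) n) z).symm

lemma planeMap_eq_eval (p : ℝ[X]) (z : ℂ) :
    planeMap p z = (p.map (algebraMap ℝ ℂ)).eval z := by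
  simp [planeMap, aeval_def, eval_map]

lemma planeMap_ofReal (p : ℝ[X]) (x : ℝ) : planeMap p x = ((p.eval x : ℝ) : ℂ) := by
  simpa [planeMap] using aeval_algebraMap_apply ℂ x p

lemma planeMap_conj (p : ℝ[X]) (z : ℂ) :
    planeMap p ((starRingEnd ℂ) z) = (starRingEnd ℂ) (planeMap p z) := by
  simpa [planeMap] using aeval_algHom_apply (Complex.conjAe.toAlgHom) z p

/-! ### Escape to infinity and compactness of the filled Julia set. -/

lemma tendsto_planeMap_div_pow {p : ℝ[X]} (hp : p.Monic) :
    Tendsto (fun z => planeMap p z / z ^ p.natDegree) (cobounded ℂ) (𝓝 1) := by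
  have h := isEquivalent_cobounded_leading_monomial (P := p.map (algebraMap ℝ ℂ))
  have h2 := (isEquivalent_iff_tendsto_one (by
    filter_upwards [eventually_ne_cobounded (0 : ℂ)] with z hz
    simp [(hp.map (algebraMap ℝ ℂ)).leadingCoeff, hz])).1 h
  refine h2.congr fun z => ?_
  simp [(hp.map (algebraMap ℝ ℂ)).leadingCoeff, planeMap_eq_eval]

lemma exists_escape_radius {p : ℝ[X]} (hp : p.Monic) (hdeg : 2 ≤ p.natDegree) :
    ∃ R : ℝ, 1 ≤ R ∧ ∀ z : ℂ, R ≤ ‖z‖ → 2 * ‖z‖ ≤ ‖planeMap p z‖ := by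
  have h := (tendsto_planeMap_div_pow hp).norm.eventually
    (lt_mem_nhds (show (1 / 2 : ℝ) < ‖(1 : ℂ)‖ by norm_num))
  obtain ⟨r, hr⟩ := (hasBasis_cobounded_norm (E := ℂ)).eventually_iff.1 h
  -- Beyond r, |p(z)| > |z|^d/2 ≥ |z|²/2, which is at least 2|z| once |z| ≥ 4.
  refine ⟨max r 4, le_max_of_le_right (by norm_num), fun z hz => ?_⟩
  have h1 := hr.2 (show r ≤ ‖z‖ from (le_max_left _ _).trans hz)
  have h4 : 4 ≤ ‖z‖ := (le_max_right _ _).trans hz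
  rw [norm_div, norm_pow, lt_div_iff₀ (by positivity)] at h1
  have : ‖z‖ ^ 2 ≤ ‖z‖ ^ p.natDegree := pow_le_pow_right₀ (by linarith) hdeg
  nlinarith

lemma norm_iterate_ge {p : ℝ[X]} {R : ℝ}
    (hR : ∀ z : ℂ, R ≤ ‖z‖ → 2 * ‖z‖ ≤ ‖planeMap p z‖) {z : ℂ} (hz : R ≤ ‖z‖) (n : ℕ) :
    2 ^ n * ‖z‖ ≤ ‖(planeMap p)^[n] z‖ := by
  induction n with
  | zero => simp
  | succ n ih =>
    rw [Function.iterate_succ_apply']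
    have : ‖z‖ ≤ 2 ^ n * ‖z‖ := le_mul_of_one_le_left (norm_nonneg _) (one_le_pow₀ one_le_two)
    have := hR _ ((hz.trans this).trans ih)
    rw [pow_succ]
    linarith

lemma notMem_filledJuliaSet_iff {p : ℝ[X]} {R : ℝ} (hR1 : 1 ≤ R)
    (hR : ∀ z : ℂ, R ≤ ‖z‖ → 2 * ‖z‖ ≤ ‖planeMap p z‖) {z : ℂ} :
    z ∉ filledJuliaSet p ↔ ∃ n : ℕ, R < ‖(planeMap p)^[n] z‖ := by
  constructor
  · intro h
    by_contra! h'
    exact h ⟨R, h'⟩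
  · rintro ⟨n, hn⟩ ⟨M, hM⟩
    obtain ⟨m, hm⟩ := pow_unbounded_of_one_lt M (one_lt_two (α := ℝ))
    have h1 := norm_iterate_ge hR hn.le m
    rw [← Function.iterate_add_apply] at h1
    have h2 := hM (m + n)
    have : (2 : ℝ) ^ m ≤ 2 ^ m * ‖(planeMap p)^[n] z‖ :=
      le_mul_of_one_le_right (by positivity) (by linarith)
    linarith

lemma isCompact_filledJuliaSet {p : ℝ[X]} (hp : p.Monic) (hdeg : 2 ≤ p.natDegree) :
    IsCompact (filledJuliaSet p) := by
  obtain ⟨R, hR1, hR⟩ := exists_escape_radius hp hdeg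
  have hK : filledJuliaSet p = ⋂ n : ℕ, {z | ‖(planeMap p)^[n] z‖ ≤ R} := by
    ext z
    have := (notMem_filledJuliaSet_iff hR1 hR (z := z)).not
    push Not at this
    simpa using this
  have hcl : IsClosed (filledJuliaSet p) := by
    rw [hK]
    exact isClosed_iInter fun n =>
      isClosed_le ((continuous_planeMap p).iterate n).norm continuous_const
  refine Metric.isCompact_of_isClosed_isBounded hcl
    ((Metric.isBounded_closedBall (x := (0 : ℂ)) (r := R)).subset fun z hz => ?_)
  rw [hK, Set.mem_iInter] at hz
  simpa using hz 0

lemma mem_filledJuliaSet_of_planeMap {p : ℝ[X]} {z : ℂ}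
    (h : planeMap p z ∈ filledJuliaSet p) : z ∈ filledJuliaSet p := by
  obtain ⟨M, hM⟩ := h
  refine ⟨max M ‖z‖, fun n => ?_⟩
  cases n with
  | zero => simp
  | succ n => exact (hM n).trans (le_max_left _ _)

lemma zero_mem_filledJuliaSet {p : ℝ[X]} (hp0 : p.eval 0 = 0) : (0 : ℂ) ∈ filledJuliaSet p := by
  have h0 : planeMap p 0 = 0 := by simpa [hp0] using planeMap_ofReal p 0
  exact ⟨0, fun n => by rw [Function.iterate_fixed h0]; simp⟩

/-! ### Chordal estimates; filled Julia set versus Julia set. -/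

lemma chordalDist_coe (z w : ℂ) : chordalDist (z : OnePoint ℂ) (w : OnePoint ℂ) =
    2 * ‖z - w‖ / (Real.sqrt (1 + ‖z‖ ^ 2) * Real.sqrt (1 + ‖w‖ ^ 2)) := rfl

lemma one_le_sqrt_one_add_sq (x : ℝ) : 1 ≤ Real.sqrt (1 + x ^ 2) :=
  Real.one_le_sqrt.2 (by nlinarith [sq_nonneg x])

lemma le_sqrt_one_add_sq (x : ℝ) : x ≤ Real.sqrt (1 + x ^ 2) :=
  Real.le_sqrt_of_sq_le (by linarith)

lemma chordalDist_coe_le (z w : ℂ) :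
    chordalDist (z : OnePoint ℂ) (w : OnePoint ℂ) ≤ 2 * ‖z - w‖ := by
  rw [chordalDist_coe]
  exact div_le_self (by positivity)
    (one_le_mul_of_one_le_of_one_le (one_le_sqrt_one_add_sq _) (one_le_sqrt_one_add_sq _))

lemma chordalDist_coe_le_of_le_norm {T : ℝ} (hT : 0 < T) {z w : ℂ} (hz : T ≤ ‖z‖)
    (hw : T ≤ ‖w‖) : chordalDist (z : OnePoint ℂ) (w : OnePoint ℂ) ≤ 4 / T := by
  have hz0 : 0 < ‖z‖ := hT.trans_le hz
  have hw0 : 0 < ‖w‖ := hT.trans_le hw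
  rw [chordalDist_coe]
  calc _ ≤ 2 * (‖z‖ + ‖w‖) / (‖z‖ * ‖w‖) := by
        gcongr
        · exact norm_sub_le _ _
        · exact le_sqrt_one_add_sq _
        · exact le_sqrt_one_add_sq _
    _ = 2 / ‖w‖ + 2 / ‖z‖ := by field_simp
    _ ≤ 2 / T + 2 / T := by gcongr
    _ = 4 / T := by ring

lemma norm_sub_le_of_chordalDist_coe {M : ℝ} {z w : ℂ} (hz : ‖z‖ ≤ M) (hw : ‖w‖ ≤ M) :
    2 * ‖z - w‖ ≤ chordalDist (z : OnePoint ℂ) (w : OnePoint ℂ) * (1 + M ^ 2) := by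
  have h1 := one_le_sqrt_one_add_sq ‖z‖
  have h2 := one_le_sqrt_one_add_sq ‖w‖
  rw [chordalDist_coe, div_mul_eq_mul_div, le_div_iff₀ (by positivity)]
  gcongr
  calc Real.sqrt (1 + ‖z‖ ^ 2) * Real.sqrt (1 + ‖w‖ ^ 2)
      ≤ Real.sqrt (1 + M ^ 2) * Real.sqrt (1 + M ^ 2) := by gcongr
    _ = 1 + M ^ 2 := Real.mul_self_sqrt (by positivity)

lemma le_chordalDist_coe {M : ℝ} {z w : ℂ} (hz : ‖z‖ ≤ M) (hw : 2 * M + 1 ≤ ‖w‖) :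
    1 / Real.sqrt (1 + M ^ 2) ≤ chordalDist (z : OnePoint ℂ) (w : OnePoint ℂ) := by
  have h1 := one_le_sqrt_one_add_sq ‖z‖
  have h2 := one_le_sqrt_one_add_sq ‖w‖
  have h3 : Real.sqrt (1 + ‖w‖ ^ 2) ≤ 1 + ‖w‖ :=
    Real.sqrt_le_iff.2 ⟨by positivity, by nlinarith [norm_nonneg w]⟩
  have h4 : ‖w‖ - ‖z‖ ≤ ‖z - w‖ := by rw [norm_sub_rev]; exact norm_sub_norm_le _ _
  calc 1 / Real.sqrt (1 + M ^ 2) ≤ 1 / Real.sqrt (1 + ‖z‖ ^ 2) := by gcongr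
    _ ≤ _ := by
      rw [chordalDist_coe, div_le_div_iff₀ (by positivity) (by positivity)]
      nlinarith

lemma mem_fatouSet_of_notMem_filledJuliaSet {p : ℝ[X]} (hp : p.Monic) (hdeg : 2 ≤ p.natDegree)
    {z : ℂ} (hz : z ∉ filledJuliaSet p) : (z : OnePoint ℂ) ∈ fatouSet p := by
  obtain ⟨R, hR1, hR⟩ := exists_escape_radius hp hdeg
  obtain ⟨N, hN⟩ := (notMem_filledJuliaSet_iff hR1 hR).1 hz
  set M := ‖z‖ + 1
  refine ⟨(↑) '' (Metric.ball z 1 ∩ {y | R < ‖(planeMap p)^[N] y‖}),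
    OnePoint.isOpen_image_coe.2 (Metric.isOpen_ball.inter
      (isOpen_lt continuous_const ((continuous_planeMap p).iterate N).norm)),
    ⟨z, ⟨Metric.mem_ball_self one_pos, hN⟩, rfl⟩, ?_⟩
  have hbd : ∀ y ∈ Metric.ball z 1, ‖y‖ ≤ M := fun y hy => by
    have := norm_le_norm_add_norm_sub' y z
    have := (mem_ball_iff_norm.1 hy).le
    linarith
  rintro _ ⟨x, ⟨hxb, hx⟩, rfl⟩ ε hε
  -- From time N + m on, both orbits have modulus at least 2^m > 4/ε, so they are chordally ε-close.
  -- The finitely many earlier iterates are handled by continuity.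
  obtain ⟨m, hm⟩ := pow_unbounded_of_one_lt (4 / ε) (one_lt_two (α := ℝ))
  have hcont : ∀ᶠ y in 𝓝 x, ∀ n ∈ Finset.range (N + m),
      ‖(planeMap p)^[n] x - (planeMap p)^[n] y‖ < ε / 2 := by
    rw [Filter.eventually_all_finset]
    intro n _
    have h : Tendsto (fun y => ‖(planeMap p)^[n] x - (planeMap p)^[n] y‖) (𝓝 x) (𝓝 0) := by
      have := ((continuous_const (y := (planeMap p)^[n] x)).sub
        ((continuous_planeMap p).iterate n)).norm.tendsto x
      simpa using this
    exact h.eventually (gt_mem_nhds (half_pos hε))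
  obtain ⟨δ, hδ, hball⟩ := Metric.eventually_nhds_iff.1 hcont
  refine ⟨2 * δ / (1 + M ^ 2), by positivity, ?_⟩
  rintro _ ⟨y, ⟨hyb, hy⟩, rfl⟩ hxy n
  rw [sphereMap_iterate_coe, sphereMap_iterate_coe]
  rcases lt_or_ge n (N + m) with hn | hn
  · have h1 := norm_sub_le_of_chordalDist_coe (hbd x hxb) (hbd y hyb)
    rw [lt_div_iff₀ (by positivity)] at hxy
    have h2 := hball (y := y) (by rw [dist_comm, dist_eq_norm]; linarith) n
      (Finset.mem_range.2 hn)
    have h3 := chordalDist_coe_le ((planeMap p)^[n] x) ((planeMap p)^[n] y)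
    linarith
  · have hlow : ∀ u : ℂ, R < ‖(planeMap p)^[N] u‖ → 2 ^ m ≤ ‖(planeMap p)^[n] u‖ := by
      intro u hu
      have h := norm_iterate_ge hR hu.le (n - N)
      rw [← Function.iterate_add_apply, Nat.sub_add_cancel (by omega)] at h
      calc (2 : ℝ) ^ m ≤ 2 ^ (n - N) := pow_le_pow_right₀ one_le_two (by omega)
        _ ≤ 2 ^ (n - N) * ‖(planeMap p)^[N] u‖ :=
          le_mul_of_one_le_right (by positivity) (by linarith)
        _ ≤ _ := h
    refine (chordalDist_coe_le_of_le_norm (by positivity) (hlow x hx) (hlow y hy)).trans_lt ?_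
    rw [div_lt_iff₀ hε] at hm
    rw [div_lt_iff₀ (by positivity)]
    linarith

/-- Equicontinuity at z, whose orbit stays in |u| ≤ M, would confine the orbits of nearby points to
|u| ≤ 2M + 1; but some of those points escape. -/
lemma mem_juliaSet_of_mem_closure_compl {p : ℝ[X]} {z : ℂ} (hz : z ∈ filledJuliaSet p)
    (hz' : z ∈ closure (filledJuliaSet p)ᶜ) : (z : OnePoint ℂ) ∈ juliaSet p := by
  rintro ⟨U, hU, hzU, h⟩
  obtain ⟨M, hM⟩ := hz
  obtain ⟨δ, hδ, hδ'⟩ := h z hzU (1 / Real.sqrt (1 + M ^ 2)) (by positivity)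
  have hnhds : {y : ℂ | (y : OnePoint ℂ) ∈ U} ∩ Metric.ball z (δ / 2) ∈ 𝓝 z :=
    inter_mem ((OnePoint.continuous_coe.isOpen_preimage U hU).mem_nhds hzU)
      (Metric.ball_mem_nhds _ (half_pos hδ))
  obtain ⟨y, ⟨hyU, hy⟩, hyK⟩ := mem_closure_iff_nhds.1 hz' _ hnhds
  have hyδ : chordalDist (z : OnePoint ℂ) (y : OnePoint ℂ) < δ := by
    have := chordalDist_coe_le z y
    rw [Metric.mem_ball, dist_comm, dist_eq_norm] at hy
    linarith
  have hlt := hδ' y hyU hyδ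
  refine hyK ⟨2 * M + 1, fun n => ?_⟩
  by_contra! hn
  have h1 := hlt n
  rw [sphereMap_iterate_coe, sphereMap_iterate_coe] at h1
  exact absurd h1 (not_lt.2 (le_chordalDist_coe (hM n) hn.le))

/-- If a point maximizing |Im| were nonreal, pushing it vertically away from the real axis would
leave the set, so it would be a Julia point. -/
lemma im_eq_zero_of_mem_filledJuliaSet {p : ℝ[X]} (hp : p.Monic) (hdeg : 2 ≤ p.natDegree)
    (hreal : ∀ ζ ∈ juliaSet p, ∃ x : ℝ, ζ = ((x : ℂ) : OnePoint ℂ)) {z : ℂ}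
    (hz : z ∈ filledJuliaSet p) : z.im = 0 := by
  obtain ⟨y, hyK, hy⟩ := (isCompact_filledJuliaSet hp hdeg).exists_isMaxOn ⟨z, hz⟩
    (Complex.continuous_im.abs.continuousOn)
  suffices hy0 : y.im = 0 by
    have := hy hz
    simpa [hy0] using this
  by_contra hy0
  have hcl : y ∈ closure (filledJuliaSet p)ᶜ := by
    have ht : Tendsto (fun t : ℝ => y + (t * y.im : ℝ) * Complex.I) (𝓝[>] 0) (𝓝 y) := by
      have : Continuous fun t : ℝ => y + (t * y.im : ℝ) * Complex.I := by fun_prop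
      simpa using (this.tendsto 0).mono_left nhdsWithin_le_nhds
    refine mem_closure_of_tendsto ht ?_
    filter_upwards [self_mem_nhdsWithin] with t (ht : 0 < t) hmem
    have h1 := hy hmem
    have h2 : |(1 + t) * y.im| ≤ |y.im| := by
      have h3 : (y + (t * y.im : ℝ) * Complex.I).im = (1 + t) * y.im := by
        simp; ring
      rw [← h3]
      exact h1
    rw [abs_mul, abs_of_pos (by linarith)] at h2
    nlinarith [abs_pos.2 hy0]
  obtain ⟨x, hx⟩ := hreal _ (mem_juliaSet_of_mem_closure_compl hyK hcl)
  exact hy0 (by rw [OnePoint.coe_injective hx]; simp)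

/-! ### Escape of the positive axis. -/

lemma mul_le_eval {p : ℝ[X]} {lam : ℝ} (hdeg : 2 ≤ p.natDegree) (hp0 : p.eval 0 = 0)
    (hlam : p.derivative.eval 0 = lam) (hcoeff : ∀ i : ℕ, 2 ≤ i → 0 ≤ p.coeff i) {x : ℝ}
    (hx : 0 ≤ x) : lam * x ≤ p.eval x := by
  have h0 : p.coeff 0 = 0 := by rwa [coeff_zero_eq_eval_zero]
  have h1 : p.coeff 1 = lam := by
    rw [← hlam, ← coeff_zero_eq_eval_zero, coeff_derivative]; simp
  rw [eval_eq_sum_range]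
  have := Finset.sum_le_sum_of_subset_of_nonneg (f := fun i => p.coeff i * x ^ i)
    (s := {0, 1}) (t := Finset.range (p.natDegree + 1)) (by
      intro i hi; simp at hi ⊢; omega) (by
      intro i _ hi
      exact mul_nonneg (hcoeff i (by simp at hi; omega)) (by positivity))
  simpa [h0, h1] using this

lemma pow_mul_le_iterate {p : ℝ[X]} {lam : ℝ} (hlam1 : 1 < lam)
    (hp : ∀ x : ℝ, 0 ≤ x → lam * x ≤ p.eval x) {x : ℝ} (hx : 0 ≤ x) (n : ℕ) :
    ∃ y : ℝ, (planeMap p)^[n] x = y ∧ lam ^ n * x ≤ y := by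
  induction n with
  | zero => exact ⟨x, rfl, by simp⟩
  | succ n ih =>
    obtain ⟨y, hy, hxy⟩ := ih
    have hy0 : 0 ≤ y := le_trans (by positivity) hxy
    refine ⟨p.eval y, by rw [Function.iterate_succ_apply', hy, planeMap_ofReal], ?_⟩
    refine le_trans ?_ (hp y hy0)
    rw [pow_succ', mul_assoc]
    gcongr

lemma notMem_filledJuliaSet_of_pos {p : ℝ[X]} {lam : ℝ} (hlam1 : 1 < lam)
    (hp : ∀ x : ℝ, 0 ≤ x → lam * x ≤ p.eval x) {x : ℝ} (hx : 0 < x) :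
    (x : ℂ) ∉ filledJuliaSet p := by
  rintro ⟨M, hM⟩
  obtain ⟨n, hn⟩ := pow_unbounded_of_one_lt (M / x) hlam1
  obtain ⟨y, hy, hxy⟩ := pow_mul_le_iterate hlam1 hp hx.le n
  have := hM n
  rw [hy, Complex.norm_real] at this
  rw [div_lt_iff₀ hx] at hn
  linarith [Real.le_norm_self y]

/-! ### The Poincaré function: uniqueness, reality, avoidance of the filled Julia set. -/

lemma poincare_iterate {p : ℝ[X]} {lam : ℝ} {f : ℂ → ℂ}
    (hfeq : ∀ z : ℂ, f (lam * z) = planeMap p (f z)) (n : ℕ) (z : ℂ) :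
    f (lam ^ n * z) = (planeMap p)^[n] (f z) := by
  induction n with
  | zero => simp
  | succ n ih => rw [Function.iterate_succ_apply', ← ih, ← hfeq, pow_succ', mul_assoc]

lemma isBigO_sq_of_deriv_eq_zero {u : ℂ → ℂ} (hu : Differentiable ℂ u) (h0 : u 0 = 0)
    (h1 : deriv u 0 = 0) : u =O[𝓝 0] fun z => z ^ 2 := by
  have hd : DifferentiableAt ℂ (dslope u 0) 0 :=
    ((Complex.differentiableOn_dslope univ_mem).2 hu.differentiableOn).differentiableAt univ_mem
  have hO := hd.isBigO_sub
  simp only [dslope_same, h1, sub_zero] at hO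
  refine (((isBigO_refl (fun z : ℂ => z) (𝓝 0)).mul hO).congr (fun z => ?_) fun z => ?_)
  · have := sub_smul_dslope u 0 z
    simpa [h0] using this
  · ring

/-- The difference u is O(z²), while p is μ-Lipschitz near 0 with μ < λ². So |u(z)| ≤ μⁿ|u(z/λⁿ)| ≤
C|z|²(μ/λ²)ⁿ → 0 near 0, and the functional equation propagates u = 0 to the plane. -/
lemma poincare_unique {p : ℝ[X]} {lam : ℝ} {f h : ℂ → ℂ} (hlam1 : 1 < lam)
    (hlam : p.derivative.eval 0 = lam)
    (hf : Differentiable ℂ f) (hf0 : f 0 = 0)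
    (hfeq : ∀ z : ℂ, f (lam * z) = planeMap p (f z))
    (hh : Differentiable ℂ h) (hh0 : h 0 = 0) (hderiv : deriv f 0 = deriv h 0)
    (hheq : ∀ z : ℂ, h (lam * z) = planeMap p (h z)) : f = h := by
  have hl0 : (lam : ℂ) ≠ 0 := by exact_mod_cast (by linarith : lam ≠ 0)
  have hlpos : 0 < lam := by linarith
  have hP : HasStrictDerivAt (planeMap p) (lam : ℂ) 0 := by
    have h1 := (p.map (algebraMap ℝ ℂ)).hasStrictDerivAt 0
    have h2 : (p.map (algebraMap ℝ ℂ)).derivative.eval 0 = (lam : ℂ) := by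
      rw [derivative_map, ← hlam]
      have := planeMap_ofReal p.derivative 0
      rwa [planeMap_eq_eval, Complex.ofReal_zero] at this
    rw [h2] at h1
    exact h1.congr_of_eventuallyEq (Eventually.of_forall fun z => (planeMap_eq_eval p z).symm)
  -- The midpoint of λ and λ²: above |p'(0)| = λ for the Lipschitz bound, below λ² for the decay.
  set μ : NNReal := ⟨(lam + lam ^ 2) / 2, by positivity⟩ with hμ
  have hμv : (μ : ℝ) = (lam + lam ^ 2) / 2 := rfl
  obtain ⟨s, hs, hlip⟩ := hP.hasStrictFDerivAt.exists_lipschitzOnWith_of_nnnorm_lt μ (by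
    rw [← NNReal.coe_lt_coe, coe_nnnorm, hμv]
    simp [abs_of_pos hlpos]
    nlinarith)
  set u : ℂ → ℂ := fun z => f z - h z
  obtain ⟨C, hC⟩ := (isBigO_sq_of_deriv_eq_zero (u := u) (hf.sub hh) (by simp [u, hf0, hh0])
    (by simp only [u]; rw [deriv_fun_sub hf.differentiableAt hh.differentiableAt, hderiv, sub_self])).bound
  have hfs : ∀ᶠ z in 𝓝 (0 : ℂ), f z ∈ s :=
    hf.continuous.continuousAt.eventually_mem (by rwa [hf0])
  have hhs : ∀ᶠ z in 𝓝 (0 : ℂ), h z ∈ s :=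
    hh.continuous.continuousAt.eventually_mem (by rwa [hh0])
  obtain ⟨r, hr, hball⟩ := Metric.eventually_nhds_iff_ball.1 (hC.and (hfs.and hhs))
  have hdivball : ∀ (n : ℕ) {z : ℂ}, z ∈ Metric.ball 0 r → z / (lam : ℂ) ^ n ∈ Metric.ball 0 r := by
    intro n z hz
    rw [mem_ball_zero_iff] at hz ⊢
    rw [norm_div, norm_pow, Complex.norm_real, Real.norm_of_nonneg hlpos.le]
    exact (div_le_self (norm_nonneg _) (one_le_pow₀ hlam1.le)).trans_lt hz
  have hstep : ∀ z ∈ Metric.ball (0 : ℂ) r, ‖u z‖ ≤ μ * ‖u (z / lam)‖ := by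
    intro z hz
    have hz' := hdivball 1 hz
    rw [pow_one] at hz'
    have h1 := hlip.dist_le_mul _ (hball _ hz').2.1 _ (hball _ hz').2.2
    rw [← hfeq, ← hheq, mul_div_cancel₀ _ hl0] at h1
    simpa [u, dist_eq_norm] using h1
  have hpow : ∀ (n : ℕ), ∀ z ∈ Metric.ball (0 : ℂ) r, ‖u z‖ ≤ μ ^ n * ‖u (z / lam ^ n)‖ := by
    intro n
    induction n with
    | zero => simp
    | succ n ih =>
      intro z hz
      refine (ih z hz).trans ?_
      have := hstep _ (hdivball n hz)
      rw [pow_succ, pow_succ, mul_assoc, ← div_div]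
      gcongr
  have hzero : ∀ z ∈ Metric.ball (0 : ℂ) r, u z = 0 := by
    intro z hz
    have hle : ∀ n : ℕ, ‖u z‖ ≤ C * ‖z‖ ^ 2 * (μ / lam ^ 2) ^ n := by
      intro n
      have h1 := (hball _ (hdivball n hz)).1
      calc ‖u z‖ ≤ μ ^ n * ‖u (z / lam ^ n)‖ := hpow n z hz
        _ ≤ μ ^ n * (C * ‖(z / lam ^ n) ^ 2‖) := by gcongr
        _ = C * ‖z‖ ^ 2 * (μ / lam ^ 2) ^ n := by
          simp only [norm_pow, norm_div, Complex.norm_real, Real.norm_of_nonneg hlpos.le, div_pow]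
          rw [← pow_mul, ← pow_mul, mul_comm n 2]
          ring
    have hlim : Tendsto (fun n : ℕ => C * ‖z‖ ^ 2 * ((μ : ℝ) / lam ^ 2) ^ n) atTop (𝓝 0) := by
      have := (tendsto_pow_atTop_nhds_zero_of_lt_one (r := (μ : ℝ) / lam ^ 2) (by positivity)
        (by rw [div_lt_one (by positivity), hμv]; nlinarith)).const_mul (C * ‖z‖ ^ 2)
      simpa using this
    exact norm_le_zero_iff.1 (ge_of_tendsto' hlim hle)
  funext z
  have ht : Tendsto (fun n : ℕ => z / (lam : ℂ) ^ n) atTop (𝓝 0) := by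
    have := (tendsto_pow_atTop_nhds_zero_of_norm_lt_one (x := (lam : ℂ)⁻¹) (by
      rw [norm_inv, Complex.norm_real, Real.norm_of_nonneg hlpos.le]
      exact inv_lt_one_of_one_lt₀ hlam1)).const_mul z
    simpa [div_eq_mul_inv] using this
  obtain ⟨n, hn⟩ := (ht.eventually (Metric.ball_mem_nhds 0 hr)).exists
  have h1 := poincare_iterate hfeq n (z / lam ^ n)
  have h2 := poincare_iterate hheq n (z / lam ^ n)
  rw [mul_div_cancel₀ _ (pow_ne_zero n hl0)] at h1 h2
  rw [h1, h2, sub_eq_zero.1 (hzero _ hn)]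

/-- As p is real, the conjugated function solves the same normalized equation; uniqueness applies.
-/
lemma poincare_conj {p : ℝ[X]} {lam : ℝ} {f : ℂ → ℂ} (hlam1 : 1 < lam)
    (hlam : p.derivative.eval 0 = lam)
    (hf : Differentiable ℂ f) (hf0 : f 0 = 0) (hf1 : deriv f 0 = 1)
    (hfeq : ∀ z : ℂ, f (lam * z) = planeMap p (f z)) (z : ℂ) :
    (starRingEnd ℂ) (f ((starRingEnd ℂ) z)) = f z := by
  have h := poincare_unique (h := starRingEnd ℂ ∘ f ∘ starRingEnd ℂ) hlam1 hlam hf hf0 hfeq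
    (fun z => differentiableAt_conj_conj_iff.2 hf.differentiableAt) (by simp [hf0])
    (by rw [deriv_conj_conj]; simp [hf1])
    (fun z => by simp [hfeq, planeMap_conj])
  exact (congrFun h z).symm

lemma tendsto_pow_mul_apply_div_pow {lam : ℝ} {f : ℂ → ℂ} (hlam1 : 1 < lam)
    (hf : DifferentiableAt ℂ f 0) (hf0 : f 0 = 0) (hf1 : deriv f 0 = 1) {z : ℂ} (hz : z ≠ 0) :
    Tendsto (fun n : ℕ => (lam : ℂ) ^ n * f (z / lam ^ n)) atTop (𝓝 z) := by
  have hlpos : 0 < lam := by linarith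
  have hl0 : (lam : ℂ) ≠ 0 := by exact_mod_cast hlpos.ne'
  have ht : Tendsto (fun n : ℕ => z / (lam : ℂ) ^ n) atTop (𝓝[≠] 0) := by
    refine tendsto_nhdsWithin_iff.2 ⟨?_, Eventually.of_forall fun n => ?_⟩
    · have := (tendsto_pow_atTop_nhds_zero_of_norm_lt_one (x := (lam : ℂ)⁻¹) (by
        rw [norm_inv, Complex.norm_real, Real.norm_of_nonneg hlpos.le]
        exact inv_lt_one_of_one_lt₀ hlam1)).const_mul z
      simpa [div_eq_mul_inv] using this
    · exact div_ne_zero hz (pow_ne_zero n hl0)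
  have hs := hasDerivAt_iff_tendsto_slope.1 hf.hasDerivAt
  rw [hf1] at hs
  have := (hs.comp ht).const_mul z
  rw [mul_one] at this
  refine this.congr fun n => ?_
  simp only [Function.comp, slope_def_field, hf0, sub_zero]
  field_simp

/-- Conjugation symmetry makes f real on the real line, f'(0) = 1 makes it positive at x/λⁿ for some
n, and iterating p preserves positivity. -/
lemma poincare_pos {p : ℝ[X]} {lam : ℝ} {f : ℂ → ℂ} (hlam1 : 1 < lam)
    (hlam : p.derivative.eval 0 = lam) (hp : ∀ x : ℝ, 0 ≤ x → lam * x ≤ p.eval x)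
    (hf : Differentiable ℂ f) (hf0 : f 0 = 0) (hf1 : deriv f 0 = 1)
    (hfeq : ∀ z : ℂ, f (lam * z) = planeMap p (f z)) {x : ℝ} (hx : 0 < x) :
    ∃ y : ℝ, 0 < y ∧ f x = y := by
  have hlpos : 0 < lam := by linarith
  have hl0 : (lam : ℂ) ≠ 0 := by exact_mod_cast hlpos.ne'
  have hre : ∀ t : ℝ, f t = ((f t).re : ℂ) := fun t => by
    have := poincare_conj hlam1 hlam hf hf0 hf1 hfeq t
    rw [Complex.conj_ofReal] at this
    exact (Complex.conj_eq_iff_re.1 this).symm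
  have ht := (Complex.continuous_re.tendsto _).comp
    (tendsto_pow_mul_apply_div_pow hlam1 hf.differentiableAt hf0 hf1
      (z := x) (by exact_mod_cast hx.ne'))
  obtain ⟨n, hn⟩ := (ht.eventually (lt_mem_nhds (show 0 < (x : ℂ).re by simpa))).exists
  have hn' : 0 < (f ((x / lam ^ n : ℝ) : ℂ)).re := by
    have h1 : (lam : ℂ) ^ n = ((lam ^ n : ℝ) : ℂ) := by push_cast; rfl
    simp only [Function.comp, h1, Complex.re_ofReal_mul] at hn
    push_cast at hn ⊢
    exact (pos_iff_pos_of_mul_pos hn).1 (by positivity)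
  obtain ⟨y, hy, hle⟩ := pow_mul_le_iterate hlam1 hp hn'.le n
  refine ⟨y, lt_of_lt_of_le (by positivity) hle, ?_⟩
  rw [← hy, ← hre, ← poincare_iterate hfeq]
  push_cast
  rw [mul_div_cancel₀ _ (pow_ne_zero n hl0)]

lemma poincare_notMem_filledJuliaSet {p : ℝ[X]} {lam : ℝ} {f : ℂ → ℂ} (hlam1 : 1 < lam)
    (hK : ∀ z ∈ filledJuliaSet p, z.im = 0 ∧ z.re ≤ 0)
    (hf : DifferentiableAt ℂ f 0) (hf0 : f 0 = 0) (hf1 : deriv f 0 = 1)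
    (hfeq : ∀ z : ℂ, f (lam * z) = planeMap p (f z)) {z : ℂ} (hz : z ∈ Complex.slitPlane) :
    f z ∉ filledJuliaSet p := by
  intro hmem
  have hlpos : 0 < lam := by linarith
  have hl0 : (lam : ℂ) ≠ 0 := by exact_mod_cast hlpos.ne'
  have hall : ∀ n : ℕ, f (z / lam ^ n) ∈ filledJuliaSet p := by
    intro n
    induction n with
    | zero => simpa
    | succ n ih =>
      refine mem_filledJuliaSet_of_planeMap ?_
      rw [← hfeq]
      convert ih using 2
      field_simp
      ring
  have ht := tendsto_pow_mul_apply_div_pow hlam1 hf hf0 hf1 (Complex.slitPlane_ne_zero hz)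
  have hcl : IsClosed {w : ℂ | w.im = 0 ∧ w.re ≤ 0} :=
    (isClosed_eq Complex.continuous_im continuous_const).inter
      (isClosed_le Complex.continuous_re continuous_const)
  have hlim : z ∈ {w : ℂ | w.im = 0 ∧ w.re ≤ 0} :=
    hcl.mem_of_tendsto ht (Eventually.of_forall fun n => by
      have h1 : (lam : ℂ) ^ n = ((lam ^ n : ℝ) : ℂ) := by push_cast; rfl
      obtain ⟨h2, h3⟩ := hK _ (hall n)
      change _ ∧ _
      rw [h1, Complex.re_ofReal_mul, Complex.im_ofReal_mul, ← h1, h2, mul_zero]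
      exact ⟨rfl, mul_nonpos_of_nonneg_of_nonpos (by positivity) h3⟩)
  rcases hz with h | h
  · exact absurd hlim.2 (not_le.2 h)
  · exact h hlim.1

/-! ### Strips and branches of the logarithm. -/

lemma isOpen_strip (b : ℝ) : IsOpen {w : ℂ | |w.im| < b} :=
  isOpen_lt Complex.continuous_im.abs continuous_const

lemma convex_strip (b : ℝ) : Convex ℝ {w : ℂ | |w.im| < b} := by
  have : {w : ℂ | |w.im| < b} = {w : ℂ | -b < w.im} ∩ {w : ℂ | w.im < b} := by
    ext w; exact abs_lt (a := w.im)
  rw [this]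
  exact (convex_halfSpace_im_gt _).inter (convex_halfSpace_im_lt _)

lemma convex_halfStrip (X a : ℝ) : Convex ℝ {w : ℂ | X ≤ w.re ∧ |w.im| ≤ a} := by
  have : {w : ℂ | X ≤ w.re ∧ |w.im| ≤ a} =
      {w : ℂ | X ≤ w.re} ∩ ({w : ℂ | -a ≤ w.im} ∩ {w : ℂ | w.im ≤ a}) := by
    ext w; exact and_congr_right fun _ => abs_le (a := w.im)
  rw [this]
  exact (convex_halfSpace_re_ge _).inter ((convex_halfSpace_im_ge _).inter
    (convex_halfSpace_im_le _))

lemma isCompact_rectangle (X Y a : ℝ) :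
    IsCompact {w : ℂ | (X ≤ w.re ∧ w.re ≤ Y) ∧ |w.im| ≤ a} := by
  have : {w : ℂ | (X ≤ w.re ∧ w.re ≤ Y) ∧ |w.im| ≤ a} = Set.Icc X Y ×ℂ Set.Icc (-a) a := by
    ext w
    simp [Complex.mem_reProdIm, abs_le]
  rw [this]
  exact isCompact_Icc.reProdIm isCompact_Icc

lemma exists_log_of_convex {S : Set ℂ} (hS : Convex ℝ S) (hSo : IsOpen S) {g : ℂ → ℂ}
    (hg : DifferentiableOn ℂ g S) (hg0 : ∀ w ∈ S, g w ≠ 0) {w₀ : ℂ} (hw₀ : w₀ ∈ S) :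
    ∃ l : ℂ → ℂ, DifferentiableOn ℂ l S ∧ l w₀ = Complex.log (g w₀) ∧
      ∀ w ∈ S, Complex.exp (l w) = g w := by
  obtain ⟨L, hL⟩ := hS.exists_forall_hasDerivWithinAt
    (f := fun w => deriv g w / g w) ((hg.deriv hSo).div hg hg0)
  have hL' : ∀ w ∈ S, HasDerivAt L (deriv g w / g w) w := fun w hw =>
    (hL w hw).hasDerivAt (hSo.mem_nhds hw)
  set l : ℂ → ℂ := fun w => L w - L w₀ + Complex.log (g w₀)
  have hl : ∀ w ∈ S, HasDerivAt l (deriv g w / g w) w := fun w hw =>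
    ((hL' w hw).sub_const _).add_const _
  refine ⟨l, fun w hw => (hl w hw).differentiableAt.differentiableWithinAt, by simp [l], ?_⟩
  have hder : ∀ w ∈ S, HasDerivAt (fun w => Complex.exp (-l w) * g w) 0 w := by
    intro w hw
    have h1 := ((hl w hw).neg.cexp).mul (hg.differentiableAt (hSo.mem_nhds hw)).hasDerivAt
    refine h1.congr_deriv ?_
    have := hg0 w hw
    rw [mul_assoc, neg_mul, div_mul_cancel₀ _ this]
    ring
  intro w hw
  have hconst := hSo.is_const_of_deriv_eq_zero hS.isPreconnected
    (fun w hw => (hder w hw).differentiableAt.differentiableWithinAt)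
    (fun w hw => (hder w hw).deriv) hw hw₀
  have h0 : Complex.exp (-l w₀) * g w₀ = 1 := by
    rw [Complex.exp_neg, show l w₀ = Complex.log (g w₀) by simp [l], Complex.exp_log (hg0 _ hw₀),
      inv_mul_cancel₀ (hg0 _ hw₀)]
  rw [h0, Complex.exp_neg] at hconst
  exact ((inv_mul_eq_one₀ (Complex.exp_ne_zero _)).1 hconst)

/-- A continuous branch of the logarithm of a function with values in the slit plane is the
principal branch as soon as it takes one value with imaginary part in `(-π, π)`. -/
lemma eq_log_exp_of_isPreconnected {S : Set ℂ} (hS : IsPreconnected S) {h : ℂ → ℂ}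
    (hc : ContinuousOn h S) (hslit : ∀ w ∈ S, Complex.exp (h w) ∈ Complex.slitPlane) {w₀ : ℂ}
    (hw₀ : w₀ ∈ S) (him : |(h w₀).im| < Real.pi) :
    ∀ w ∈ S, h w = Complex.log (Complex.exp (h w)) := by
  intro w hw
  have hne : ∀ v ∈ S, |(h v).im| ≠ Real.pi := by
    intro v hv hpi
    have hcos : Real.cos (h v).im = -1 := by rw [← Real.cos_abs, hpi, Real.cos_pi]
    have hsin : Real.sin (h v).im = 0 := by
      have := Real.sin_sq_add_cos_sq (h v).im
      rw [hcos] at this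
      nlinarith
    rcases hslit v hv with h1 | h1
    · rw [Complex.exp_re, hcos] at h1
      linarith [Real.exp_pos (h v).re]
    · exact h1 (by rw [Complex.exp_im, hsin, mul_zero])
  have hlt : |(h w).im| < Real.pi := by
    by_contra! hge
    obtain ⟨v, hv, hv'⟩ := hS.intermediate_value hw₀ hw
      (Complex.continuous_im.comp_continuousOn hc).abs ⟨him.le, hge⟩
    exact hne v hv hv'
  rw [abs_lt] at hlt
  rw [Complex.log_exp hlt.1 hlt.2.le]

/-! ### Correcting an approximate solution to a homogeneous one. -/

/-- Solution of the Schröder type equation `H (w + c) = d H w` asymptotic to `l` on the strip,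
where `l` solves the equation up to an error that tends to zero. -/
lemma exists_homogeneous_of_almost {b c d : ℝ} (hc : 0 < c) (hd : 2 ≤ d) {l : ℂ → ℂ}
    (hl : DifferentiableOn ℂ l {w : ℂ | |w.im| < b})
    (hq : ∀ a < b, ∀ η > (0 : ℝ), ∃ X : ℝ, ∀ w : ℂ, |w.im| ≤ a → X ≤ w.re →
      ‖l (w + c) - d * l w‖ ≤ η) :
    ∃ H : ℂ → ℂ, DifferentiableOn ℂ H {w : ℂ | |w.im| < b} ∧
      (∀ w : ℂ, |w.im| < b → H (w + c) = d * H w) ∧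
      ∀ a < b, ∀ η > (0 : ℝ), ∃ X : ℝ, ∀ w : ℂ, |w.im| ≤ a → X ≤ w.re → ‖H w - l w‖ ≤ η := by
  set T : Set ℂ := {w : ℂ | |w.im| < b}
  have hTo : IsOpen T := isOpen_strip b
  set q : ℂ → ℂ := fun w => l (w + c) - d * l w
  have hshift : ∀ (n : ℕ) {w : ℂ}, w ∈ T → w + n * c ∈ T := fun n w hw => by
    simpa [T] using hw
  have hshift1 : ∀ {w : ℂ}, w ∈ T → w + c ∈ T := fun {w} hw => by simpa [T] using hw
  have hqd : DifferentiableOn ℂ q T :=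
    (hl.comp (differentiableOn_id.add_const _) fun w hw => hshift1 hw).sub (hl.const_mul _)
  have hgeo : HasSum (fun n : ℕ => ((d⁻¹) ^ (n + 1) : ℝ)) (1 / (d - 1)) := by
    have := (hasSum_geometric_of_lt_one (r := d⁻¹) (by positivity)
      (inv_lt_one_of_one_lt₀ (by linarith))).mul_left d⁻¹
    have h1 : d⁻¹ * (1 - d⁻¹)⁻¹ = 1 / (d - 1) := by
      rw [← mul_inv, mul_sub, mul_inv_cancel₀ (by linarith), mul_one, one_div]
    simpa only [← pow_succ', h1] using this
  -- Terms of the telescoping series: l plus the first n of them is d^{-n}·l(w + nc).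
  set t : ℕ → ℂ → ℂ := fun n w => ((d⁻¹ : ℝ) : ℂ) ^ (n + 1) * q (w + n * c)
  have htd : ∀ n, DifferentiableOn ℂ (t n) T := fun n =>
    (hqd.comp (differentiableOn_id.add_const _) fun w hw => hshift n hw).const_mul _
  have hbound : ∀ a < b, ∀ X₀ : ℝ, ∃ M : ℝ, ∀ w : ℂ, |w.im| ≤ a → X₀ ≤ w.re → ‖q w‖ ≤ M := by
    intro a ha X₀
    obtain ⟨X, hX⟩ := hq a ha 1 one_pos
    obtain ⟨M, hM⟩ := (isCompact_rectangle X₀ X a).exists_bound_of_continuousOn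
      (hqd.continuousOn.mono fun w hw => lt_of_le_of_lt hw.2 ha)
    refine ⟨max M 1, fun w hw hwX => ?_⟩
    rcases le_total X w.re with h | h
    · exact (hX w hw h).trans (le_max_right _ _)
    · exact (hM w ⟨⟨hwX, h⟩, hw⟩).trans (le_max_left _ _)
  have htle : ∀ {a X₀ M : ℝ}, (∀ w : ℂ, |w.im| ≤ a → X₀ ≤ w.re → ‖q w‖ ≤ M) →
      ∀ (n : ℕ) (w : ℂ), |w.im| ≤ a → X₀ ≤ w.re → ‖t n w‖ ≤ (d⁻¹) ^ (n + 1) * M := by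
    intro a X₀ M hM n w hw hwX
    simp only [t, norm_mul, norm_pow, Complex.norm_real]
    rw [Real.norm_of_nonneg (by positivity)]
    gcongr
    refine hM _ (by simpa using hw) ?_
    have : 0 ≤ (n : ℝ) * c := by positivity
    simp
    linarith
  have hsum : ∀ w ∈ T, Summable fun n => t n w := by
    intro w hw
    obtain ⟨M, hM⟩ := hbound |w.im| hw w.re
    exact Summable.of_norm_bounded (hgeo.summable.mul_right M)
      fun n => htle hM n w le_rfl le_rfl
  refine ⟨fun w => l w + ∑' n, t n w, ?_, ?_, ?_⟩
  · refine hl.add fun w hw => DifferentiableAt.differentiableWithinAt ?_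
    obtain ⟨a, ha, hab⟩ := exists_between (show |w.im| < b from hw)
    obtain ⟨M, hM⟩ := hbound a hab (w.re - 1)
    have hUo : IsOpen {v : ℂ | |v.im| < a ∧ w.re - 1 < v.re} :=
      (isOpen_strip a).inter (isOpen_lt continuous_const Complex.continuous_re)
    refine (Complex.differentiableOn_tsum_of_summable_norm (hgeo.summable.mul_right M)
      (fun n => (htd n).mono fun v hv => lt_trans hv.1 hab) hUo
      fun n v hv => htle hM n v hv.1.le hv.2.le).differentiableAt (hUo.mem_nhds ⟨ha, by simp⟩)
  · intro w hw
    have hd0 : (d : ℂ) ≠ 0 := by exact_mod_cast (by linarith : d ≠ 0)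
    have h1 : ∀ n, t n (w + c) = d * t (n + 1) w := by
      intro n
      simp only [t]
      rw [pow_succ' _ (n + 1)]
      push_cast
      rw [← mul_assoc, ← mul_assoc, mul_inv_cancel₀ hd0, one_mul]
      ring_nf
    have h2 : d * t 0 w = q w := by
      simp [t, hd0]
    simp only [h1]
    rw [tsum_mul_left, (hsum w hw).tsum_eq_zero_add, mul_add, mul_add, h2]
    simp only [q]
    ring
  · intro a ha η hη
    obtain ⟨X, hX⟩ := hq a ha η hη
    refine ⟨X, fun w hw hwX => ?_⟩
    rw [add_sub_cancel_left]
    refine (tsum_of_norm_bounded (hgeo.mul_right η)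
      fun n => htle hX n w hw hwX).trans ?_
    -- The geometric sum 1/(d-1) is at most 1 because d ≥ 2, so the bound η is not worsened.
    refine mul_le_of_le_one_left hη.le ?_
    rw [div_le_one (by linarith)]
    linarith

/-! ### The Poincaré function in the coordinate z = exp w. -/

lemma exp_mem_slitPlane_of_abs_im_lt {w : ℂ} (hw : |w.im| < Real.pi) :
    Complex.exp w ∈ Complex.slitPlane := by
  rw [abs_lt] at hw
  have h : (Complex.exp w).arg = w.im := by
    rw [← Complex.log_im, Complex.log_exp hw.1 hw.2.le]
  exact Complex.mem_slitPlane_iff_arg.2 ⟨by rw [h]; exact hw.2.ne, Complex.exp_ne_zero w⟩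

lemma poincare_exp_add {p : ℝ[X]} {lam : ℝ} {f : ℂ → ℂ} (hlam1 : 1 < lam)
    (hfeq : ∀ z : ℂ, f (lam * z) = planeMap p (f z)) (n : ℕ) (w : ℂ) :
    f (Complex.exp (w + n * (Real.log lam : ℂ))) = (planeMap p)^[n] (f (Complex.exp w)) := by
  rw [← poincare_iterate hfeq, Complex.exp_add, Complex.exp_nat_mul, ← Complex.ofReal_exp,
    Real.exp_log (by linarith), mul_comm]

/-- On the compact rectangle 0 ≤ Re w ≤ log λ, |Im w| ≤ a, one escape time N serves all points.
Every w far to the right is a translate of a point there by n·log λ, which amounts to applying pⁿ.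
-/
lemma exists_le_norm_poincare_exp {p : ℝ[X]} {lam : ℝ} {f : ℂ → ℂ} (hp : p.Monic)
    (hdeg : 2 ≤ p.natDegree) (hlam1 : 1 < lam) (hf : Continuous f)
    (hfeq : ∀ z : ℂ, f (lam * z) = planeMap p (f z))
    (hfK : ∀ z ∈ Complex.slitPlane, f z ∉ filledJuliaSet p) {a : ℝ} (ha : a < Real.pi) (M : ℝ) :
    ∃ X : ℝ, ∀ w : ℂ, |w.im| ≤ a → X ≤ w.re → M ≤ ‖f (Complex.exp w)‖ := by
  obtain ⟨R, hR1, hR⟩ := exists_escape_radius hp hdeg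
  have hc : 0 < Real.log lam := Real.log_pos hlam1
  have hgc : Continuous fun w => f (Complex.exp w) := hf.comp Complex.continuous_exp
  have hgrow : ∀ (N k : ℕ) (z : ℂ), R < ‖(planeMap p)^[N] z‖ →
      2 ^ k * ‖(planeMap p)^[N] z‖ ≤ ‖(planeMap p)^[N + k] z‖ := fun N k z hz => by
    rw [Nat.add_comm, Function.iterate_add_apply]
    exact norm_iterate_ge hR hz.le k
  obtain ⟨N, hN⟩ := (isCompact_rectangle 0 (Real.log lam) a).elim_directed_cover
    (fun N : ℕ => {w : ℂ | R < ‖(planeMap p)^[N] (f (Complex.exp w))‖})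
    (fun N => isOpen_lt continuous_const
      (((continuous_planeMap p).iterate N).comp hgc).norm)
    (fun w hw => Set.mem_iUnion.2 <| (notMem_filledJuliaSet_iff hR1 hR).1 <|
      hfK _ (exp_mem_slitPlane_of_abs_im_lt (hw.2.trans_lt ha)))
    (Monotone.directed_le <| monotone_nat_of_le_succ fun N w (hw : R < _) =>
      show R < _ from hw.trans_le <| le_trans (le_mul_of_one_le_left (norm_nonneg _)
        (one_le_pow₀ one_le_two)) (hgrow N 1 _ hw))
  obtain ⟨k, hk⟩ := pow_unbounded_of_one_lt M (one_lt_two (α := ℝ))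
  refine ⟨(N + k : ℕ) * Real.log lam, fun w hw hwX => ?_⟩
  have hre : ((N + k : ℕ) : ℝ) ≤ w.re / Real.log lam := (le_div_iff₀ hc).2 hwX
  set n := ⌊w.re / Real.log lam⌋₊
  have hn : N + k ≤ n := Nat.le_floor hre
  have hn1 : n * Real.log lam ≤ w.re :=
    (le_div_iff₀ hc).1 (Nat.floor_le (le_trans (Nat.cast_nonneg _) hre))
  have hn2 : w.re ≤ (n + 1) * Real.log lam := ((div_lt_iff₀ hc).1 (Nat.lt_floor_add_one _)).le
  set v : ℂ := w - n * (Real.log lam : ℂ) with hv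
  have hvre : v.re = w.re - n * Real.log lam := by simp [hv]
  have hvim : v.im = w.im := by simp [hv]
  have hvN : R < ‖(planeMap p)^[N] (f (Complex.exp v))‖ :=
    hN ⟨⟨by rw [hvre]; linarith, by rw [hvre]; linarith⟩, by rwa [hvim]⟩
  have h1 := hgrow N (n - N) _ hvN
  rw [Nat.add_sub_cancel' (by omega), ← poincare_exp_add hlam1 hfeq n, hv, sub_add_cancel,
    ← hv] at h1
  calc M ≤ 2 ^ k := hk.le
    _ ≤ 2 ^ (n - N) := pow_le_pow_right₀ one_le_two (by omega)
    _ ≤ 2 ^ (n - N) * ‖(planeMap p)^[N] (f (Complex.exp v))‖ :=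
      le_mul_of_one_le_right (by positivity) (by linarith)
    _ ≤ _ := h1

/-- The logarithm of the Poincaré function in the logarithmic coordinate `z = exp w` satisfies the
equation `l (w + log lam) = d l w` up to an error that tends to zero on smaller strips. -/
lemma exists_log_poincare_exp {p : ℝ[X]} {lam : ℝ} {f : ℂ → ℂ} (hp : p.Monic)
    (hlam1 : 1 < lam) (hf : Differentiable ℂ f)
    (hfeq : ∀ z : ℂ, f (lam * z) = planeMap p (f z))
    (hf0 : ∀ z ∈ Complex.slitPlane, f z ≠ 0)
    (hpos : ∀ x : ℝ, 0 < x → ∃ y : ℝ, 0 < y ∧ f x = y)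
    (hesc : ∀ a < Real.pi, ∀ M : ℝ, ∃ X : ℝ, ∀ w : ℂ, |w.im| ≤ a → X ≤ w.re →
      M ≤ ‖f (Complex.exp w)‖) :
    ∃ l : ℂ → ℂ, DifferentiableOn ℂ l {w : ℂ | |w.im| < Real.pi} ∧
      (∀ w : ℂ, |w.im| < Real.pi → Complex.exp (l w) = f (Complex.exp w)) ∧
      ∀ a < Real.pi, ∀ η > (0 : ℝ), ∃ X : ℝ, ∀ w : ℂ, |w.im| ≤ a → X ≤ w.re →
        ‖l (w + (Real.log lam : ℝ)) - (p.natDegree : ℝ) * l w‖ ≤ η := by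
  set T : Set ℂ := {w : ℂ | |w.im| < Real.pi}
  have h0T : (0 : ℂ) ∈ T := by simp [T, Real.pi_pos]
  obtain ⟨l, hl, hl0, hexp⟩ := exists_log_of_convex (convex_strip Real.pi) (isOpen_strip Real.pi)
    (g := fun w => f (Complex.exp w)) (hf.comp Complex.differentiable_exp).differentiableOn
    (fun w hw => hf0 _ (exp_mem_slitPlane_of_abs_im_lt hw)) h0T
  refine ⟨l, hl, hexp, ?_⟩
  have hexpreal : ∀ x : ℝ, ∃ y : ℝ, 0 < y ∧ Complex.exp (l x) = y := fun x => by
    obtain ⟨y, hy, hfy⟩ := hpos _ (Real.exp_pos x)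
    exact ⟨y, hy, by rw [hexp x (by simp [Real.pi_pos])]; simpa using hfy⟩
  -- Reality of l on the axis excludes a multiple of 2πi in the error q: only exp(q) → 1 is known
  -- from p(u)/u^d → 1.
  have hlreal : ∀ x : ℝ, (l x).im = 0 := by
    have hcast : ∀ w : ℂ, w.im = 0 → w = (w.re : ℂ) := fun w hw =>
      Complex.ext (by simp) (by simp [hw])
    have hconv : Convex ℝ {w : ℂ | w.im = 0} := convex_hyperplane Complex.imLm.isLinear 0
    have hbranch := eq_log_exp_of_isPreconnected hconv.isPreconnected (h := l)
      (hl.continuousOn.mono fun w (hw : w.im = 0) => by simp [hw, Real.pi_pos])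
      (fun w hw => by
        obtain ⟨y, hy, hly⟩ := hexpreal w.re
        rw [hcast w hw, hly]
        exact Complex.ofReal_mem_slitPlane.2 hy)
      (w₀ := 0) (by simp) (by
        obtain ⟨y, hy, hly⟩ := hpos 1 one_pos
        rw [hl0, Complex.exp_zero, ← Complex.ofReal_one, hly, ← Complex.ofReal_log hy.le]
        simp [Real.pi_pos])
    intro x
    obtain ⟨y, hy, hly⟩ := hexpreal x
    rw [hbranch x (by simp), hly, ← Complex.ofReal_log hy.le, Complex.ofReal_im]
  intro a ha η hη
  set c := Real.log lam
  set d := p.natDegree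
  rcases lt_or_ge a 0 with ha0 | ha0
  · exact ⟨0, fun w hw => absurd (hw.trans_lt ha0) (not_lt.2 (abs_nonneg _))⟩
  set q : ℂ → ℂ := fun w => l (w + c) - (d : ℝ) * l w
  have hshift : ∀ {w : ℂ}, w ∈ T → w + c ∈ T := fun {w} hw => by simpa [T] using hw
  have hexpq : ∀ w ∈ T, Complex.exp (q w) =
      planeMap p (f (Complex.exp w)) / f (Complex.exp w) ^ d := by
    intro w hw
    have h1 := poincare_exp_add hlam1 hfeq 1 w
    simp only [Nat.cast_one, one_mul, Function.iterate_one] at h1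
    simp only [q]
    rw [Complex.exp_sub, hexp _ (hshift hw), Complex.ofReal_natCast, Complex.exp_nat_mul,
      hexp w hw, h1]
  have hqc : ContinuousOn q T :=
    ((hl.comp (differentiableOn_id.add_const _) fun w hw => hshift hw).sub
      (hl.const_mul _)).continuousOn
  have hlog : ∀ᶠ u in 𝓝 (1 : ℂ), u ∈ Complex.slitPlane ∧ ‖Complex.log u‖ < η := by
    refine Eventually.and (Complex.isOpen_slitPlane.mem_nhds Complex.one_mem_slitPlane) ?_
    have := (continuousAt_clog Complex.one_mem_slitPlane).norm
    exact this.eventually (gt_mem_nhds (by simpa using hη))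
  obtain ⟨M, -, hM⟩ := (hasBasis_cobounded_norm (E := ℂ)).eventually_iff.1
    ((tendsto_planeMap_div_pow hp).eventually hlog)
  obtain ⟨X, hX⟩ := hesc a ha M
  have hnear : ∀ w ∈ {w : ℂ | X ≤ w.re ∧ |w.im| ≤ a},
      Complex.exp (q w) ∈ Complex.slitPlane ∧ ‖Complex.log (Complex.exp (q w))‖ < η := by
    intro w hw
    rw [hexpq w (hw.2.trans_lt ha)]
    exact hM (hX w hw.2 hw.1)
  have hbranch := eq_log_exp_of_isPreconnected (convex_halfStrip X a).isPreconnected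
    (hqc.mono fun w hw => hw.2.trans_lt ha) (fun w hw => (hnear w hw).1)
    (w₀ := (X : ℂ)) (by simpa using ha0) (by
      have h1 : (q X).im = 0 := by
        simp only [q]
        rw [Complex.sub_im, Complex.im_ofReal_mul, hlreal, ← Complex.ofReal_add, hlreal]
        simp
      simp [h1, Real.pi_pos])
  refine ⟨X, fun w hw hwX => ?_⟩
  change ‖q w‖ ≤ η
  rw [hbranch w ⟨hwX, hw⟩]
  exact (hnear w ⟨hwX, hw⟩).2.le

lemma add_nat_mul_eq_pow_mul {b c d : ℝ} {H : ℂ → ℂ}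
    (hH : ∀ w : ℂ, |w.im| < b → H (w + c) = d * H w) {w : ℂ} (hw : |w.im| < b) (n : ℕ) :
    H (w + n * c) = d ^ n * H w := by
  induction n with
  | zero => simp
  | succ n ih =>
    rw [pow_succ', mul_assoc, ← ih, ← hH _ (by simpa using hw)]
    push_cast
    ring_nf

/-- The real part of a homogeneous function, rescaled to be periodic, is bounded above and below
on a closed strip by positive constants if it is positive. -/
lemma exists_bounds_of_homogeneous {b c d ρ : ℝ} (hc : 0 < c) (hd : Real.exp (ρ * c) = d)
    {H : ℂ → ℂ} (hcont : ContinuousOn H {w : ℂ | |w.im| < b})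
    (hH : ∀ w : ℂ, |w.im| < b → H (w + c) = d * H w)
    (hpos : ∀ w : ℂ, |w.im| < b → 0 < (H w).re) {a : ℝ} (ha : a < b) :
    ∃ A B : ℝ, 0 < A ∧ 0 < B ∧ ∀ w : ℂ, |w.im| ≤ a →
      A ≤ Real.exp (-(ρ * w.re)) * (H w).re ∧ Real.exp (-(ρ * w.re)) * (H w).re ≤ B := by
  rcases lt_or_ge a 0 with ha0 | ha0
  · exact ⟨1, 1, one_pos, one_pos, fun w hw =>
      absurd (hw.trans_lt ha0) (not_lt.2 (abs_nonneg _))⟩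
  set φ : ℂ → ℝ := fun w => Real.exp (-(ρ * w.re)) * (H w).re
  have hφpos : ∀ w : ℂ, |w.im| < b → 0 < φ w := fun w hw => mul_pos (Real.exp_pos _) (hpos w hw)
  have hφc : ContinuousOn φ {w : ℂ | |w.im| < b} := by
    have h1 : Continuous fun w : ℂ => Real.exp (-(ρ * w.re)) := by fun_prop
    exact h1.continuousOn.mul (Complex.continuous_re.comp_continuousOn hcont)
  have hper : ∀ w : ℂ, |w.im| < b → φ (w + c) = φ w := by
    intro w hw
    simp only [φ]
    rw [hH w hw, Complex.re_ofReal_mul, ← hd, Complex.add_re, Complex.ofReal_re, mul_add, neg_add,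
      Real.exp_add, Real.exp_neg (ρ * c)]
    field_simp
  set Q := {w : ℂ | (0 ≤ w.re ∧ w.re ≤ c) ∧ |w.im| ≤ a}
  have hQ : IsCompact Q := isCompact_rectangle 0 c a
  have hQb : Q ⊆ {w : ℂ | |w.im| < b} := fun w hw => hw.2.trans_lt ha
  have hne : Q.Nonempty := ⟨0, by simp [Q, hc.le, ha0]⟩
  obtain ⟨u, hu, hmin⟩ := hQ.exists_isMinOn hne (hφc.mono hQb)
  obtain ⟨v, hv, hmax⟩ := hQ.exists_isMaxOn hne (hφc.mono hQb)
  refine ⟨φ u, φ v, hφpos u (hQb hu), hφpos v (hQb hv), fun w hw => ?_⟩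
  have hp : Function.Periodic (fun x : ℝ => φ (x + w.im * Complex.I)) c := fun x => by
    have := hper (x + w.im * Complex.I) (by simpa using hw.trans_lt ha)
    simp only
    rw [← this]
    push_cast
    ring_nf
  -- Periodicity moves w into the compact rectangle where the extrema were taken.
  obtain ⟨x, hx, hxw⟩ := hp.exists_mem_Ico₀ hc w.re
  simp only [Complex.re_add_im] at hxw
  have hxQ : (x + w.im * Complex.I : ℂ) ∈ Q := ⟨by simpa using ⟨hx.1, hx.2.le⟩, by simpa using hw⟩
  change φ u ≤ φ w ∧ φ w ≤ φ v
  rw [hxw]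
  exact ⟨hmin hxQ, hmax hxQ⟩

end PolyDynamics

/-! ### Assembly of the theorem. -/

theorem mainTheorem11 (p : Polynomial ℝ) (lam ρ : ℝ) (f : ℂ → ℂ)
    -- `p` is monic of degree at least two with `p(0) = 0` and `p'(0) = lam > 1`
    (hmonic : p.Monic) (hdeg : 2 ≤ p.natDegree) (hp0 : p.eval 0 = 0)
    (hlam : p.derivative.eval 0 = lam) (hlam1 : 1 < lam)
    (hρ : ρ = Real.log p.natDegree / Real.log lam)
    -- `f` is the entire solution of the Poincaré equation, normalised at the origin
    (hf : Differentiable ℂ f) (hf0 : f 0 = 0) (hf1 : deriv f 0 = 1)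
    (hfeq : ∀ z : ℂ, f ((lam : ℂ) * z) = Polynomial.aeval (f z) p)
    -- the Julia set is real and the coefficients from index two on are non-negative
    (hreal : ∀ ζ ∈ PolyDynamics.juliaSet p, ∃ x : ℝ, ζ = ((x : ℂ) : OnePoint ℂ))
    (hcoeff : ∀ i : ℕ, 2 ≤ i → 0 ≤ p.coeff i) :
    (∀ ζ ∈ PolyDynamics.juliaSet p, ∃ x : ℝ, x ≤ 0 ∧ ζ = ((x : ℂ) : OnePoint ℂ)) ∧
    ∃ F : ℂ → ℂ,
      DifferentiableOn ℂ F {w : ℂ | |w.im| < Real.pi / Real.log lam} ∧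
      (∀ w : ℂ, |w.im| < Real.pi / Real.log lam → F (w + 1) = F w) ∧
      (∀ ε > (0 : ℝ),
        f ~[Bornology.cobounded ℂ ⊓ 𝓟 {z : ℂ | |z.arg| ≤ Real.pi - ε}]
          fun z => Complex.exp (z ^ (ρ : ℂ) * F (Complex.log z / (Real.log lam : ℂ)))) ∧
      (∀ ε > (0 : ℝ), ∃ A B : ℝ, 0 < A ∧ 0 < B ∧
        ∀ z : ℂ, z ≠ 0 → |z.arg| ≤ Real.pi - ε →
          A ≤ (Complex.exp (Complex.I * (ρ : ℂ) * (z.arg : ℂ)) *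
              F (Complex.log z / (Real.log lam : ℂ))).re ∧
          (Complex.exp (Complex.I * (ρ : ℂ) * (z.arg : ℂ)) *
              F (Complex.log z / (Real.log lam : ℂ))).re ≤ B) := by
  have hfeq' : ∀ z : ℂ, f ((lam : ℂ) * z) = PolyDynamics.planeMap p (f z) := hfeq
  have hp : ∀ x : ℝ, 0 ≤ x → lam * x ≤ p.eval x := fun x hx =>
    PolyDynamics.mul_le_eval hdeg hp0 hlam hcoeff hx
  have hnotpos : ∀ x : ℝ, 0 < x → (x : ℂ) ∉ PolyDynamics.filledJuliaSet p := fun x hx =>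
    PolyDynamics.notMem_filledJuliaSet_of_pos hlam1 hp hx
  have hK : ∀ z ∈ PolyDynamics.filledJuliaSet p, z.im = 0 ∧ z.re ≤ 0 := by
    intro z hz
    have him := PolyDynamics.im_eq_zero_of_mem_filledJuliaSet hmonic hdeg hreal hz
    refine ⟨him, not_lt.1 fun hre => hnotpos z.re hre ?_⟩
    rwa [show (z.re : ℂ) = z from Complex.ext (by simp) (by simp [him])]
  refine ⟨fun ζ hζ => ?_, ?_⟩
  · obtain ⟨x, rfl⟩ := hreal ζ hζ
    refine ⟨x, not_lt.1 fun hx => hζ ?_, rfl⟩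
    exact PolyDynamics.mem_fatouSet_of_notMem_filledJuliaSet hmonic hdeg (hnotpos x hx)
  have hfK : ∀ z ∈ Complex.slitPlane, f z ∉ PolyDynamics.filledJuliaSet p := fun z hz =>
    PolyDynamics.poincare_notMem_filledJuliaSet hlam1 hK hf.differentiableAt hf0 hf1 hfeq' hz
  have hfne : ∀ z ∈ Complex.slitPlane, f z ≠ 0 := fun z hz h0 =>
    hfK z hz (h0 ▸ PolyDynamics.zero_mem_filledJuliaSet hp0)
  have hesc : ∀ a < Real.pi, ∀ M : ℝ, ∃ X : ℝ, ∀ w : ℂ, |w.im| ≤ a → X ≤ w.re →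
      M ≤ ‖f (Complex.exp w)‖ := fun a ha M =>
    PolyDynamics.exists_le_norm_poincare_exp hmonic hdeg hlam1 hf.continuous hfeq' hfK ha M
  obtain ⟨l, hl, hexp, hq⟩ := PolyDynamics.exists_log_poincare_exp hmonic hlam1 hf hfeq' hfne
    (fun x hx => PolyDynamics.poincare_pos hlam1 hlam hp hf hf0 hf1 hfeq' hx) hesc
  have hc : 0 < Real.log lam := Real.log_pos hlam1
  have hd2 : (2 : ℝ) ≤ p.natDegree := by exact_mod_cast hdeg
  obtain ⟨H, hHd, hH, hHl⟩ := PolyDynamics.exists_homogeneous_of_almost hc hd2 hl hq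
  set c := Real.log lam
  have hρc : Real.exp (ρ * c) = p.natDegree := by
    rw [hρ, div_mul_cancel₀ _ hc.ne', Real.exp_log (by linarith)]
  have hHpos : ∀ w : ℂ, |w.im| < Real.pi → 0 < (H w).re := by
    intro w hw
    obtain ⟨X₁, hX₁⟩ := hHl _ hw 1 one_pos
    -- Far to the right Re l ≥ 2 and |H - l| ≤ 1, so Re H > 0; dividing by dⁿ brings this back to w.
    obtain ⟨X₂, hX₂⟩ := hesc _ hw (Real.exp 2)
    obtain ⟨n, hn⟩ := exists_nat_ge ((max X₁ X₂ - w.re) / c)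
    rw [div_le_iff₀ hc] at hn
    set v : ℂ := w + n * c with hv
    have hvre : v.re = w.re + n * c := by simp [hv]
    have hvim : v.im = w.im := by simp [hv]
    have h1 := hX₁ v (by rw [hvim]) (by
      rw [hvre]; linarith [le_max_left X₁ X₂])
    have h2 := hX₂ v (by rw [hvim]) (by
      rw [hvre]; linarith [le_max_right X₁ X₂])
    rw [← hexp v (by rwa [hvim]), Complex.norm_exp, Real.exp_le_exp] at h2
    have h3 := (abs_le.1 ((Complex.abs_re_le_norm _).trans h1)).1
    rw [Complex.sub_re] at h3
    have h4 : 0 < (H v).re := by linarith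
    rw [hv, PolyDynamics.add_nat_mul_eq_pow_mul hH hw, ← Complex.ofReal_pow,
      Complex.re_ofReal_mul] at h4
    exact (pos_iff_pos_of_mul_pos h4).1 (by positivity)
  have hlogdiv : ∀ z : ℂ, (c : ℂ) * (Complex.log z / c) = Complex.log z := fun z =>
    mul_div_cancel₀ _ (by exact_mod_cast hc.ne')
  have him : ∀ w : ℂ, |w.im| < Real.pi / c → |((c : ℂ) * w).im| < Real.pi := by
    intro w hw
    rw [Complex.im_ofReal_mul, abs_mul, abs_of_pos hc, mul_comm]
    exact (lt_div_iff₀ hc).1 hw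
  -- Chosen so that z^ρ·F(log z/c) = H(log z).
  refine ⟨fun w => H (c * w) * Complex.exp (-(ρ * (c * w))), ?_, ?_, ?_, ?_⟩
  · exact (hHd.comp (differentiableOn_id.const_mul _) fun w hw => him w hw).mul
      (by fun_prop : Differentiable ℂ fun w : ℂ =>
        Complex.exp (-(ρ * (c * w)))).differentiableOn
  · intro w hw
    have hexpc : Complex.exp (-(ρ * (c * (w + 1)))) * (p.natDegree : ℝ) =
        Complex.exp (-(ρ * (c * w))) := by
      rw [← hρc, Complex.ofReal_exp, ← Complex.exp_add]
      push_cast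
      ring_nf
    simp only
    rw [← hexpc, mul_add (c : ℂ) w, mul_one, hH _ (him w hw)]
    ring
  · intro ε hε
    have hlt : Real.pi - ε < Real.pi := by linarith
    refine isEquivalent_of_tendsto_one ?_
    have hlim : Tendsto (fun z : ℂ => l (Complex.log z) - H (Complex.log z))
        (Bornology.cobounded ℂ ⊓ 𝓟 {z : ℂ | |z.arg| ≤ Real.pi - ε}) (𝓝 0) := by
      rw [Metric.tendsto_nhds]
      intro η hη
      obtain ⟨X, hX⟩ := hHl _ hlt (η / 2) (half_pos hη)
      rw [eventually_inf_principal]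
      filter_upwards [(tendsto_norm_cobounded_atTop (E := ℂ)).eventually_ge_atTop (Real.exp X)]
        with z hz harg
      have hz0 : 0 < ‖z‖ := (Real.exp_pos X).trans_le hz
      have h := hX (Complex.log z) (by rwa [Complex.log_im]) (by
        rw [Complex.log_re]
        exact (Real.le_log_iff_exp_le hz0).2 hz)
      rw [dist_zero_right, norm_sub_rev]
      linarith
    have hlim' := (Complex.continuous_exp.tendsto 0).comp hlim
    rw [Complex.exp_zero] at hlim'
    refine hlim'.congr' ?_
    rw [EventuallyEq, eventually_inf_principal]
    filter_upwards [Bornology.eventually_ne_cobounded (0 : ℂ)] with z hz0 harg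
    have hzl := hexp (Complex.log z) (by
      rw [Complex.log_im]; exact lt_of_le_of_lt harg hlt)
    rw [Complex.exp_log hz0] at hzl
    simp only [Function.comp, Pi.div_apply]
    rw [Complex.exp_sub, hzl, hlogdiv, Complex.cpow_def_of_ne_zero hz0, mul_left_comm,
      ← Complex.exp_add]
    congr 2
    rw [mul_comm (Complex.log z), add_neg_cancel, Complex.exp_zero, mul_one]
  · intro ε hε
    obtain ⟨A, B, hA, hB, hAB⟩ := PolyDynamics.exists_bounds_of_homogeneous hc hρc
      hHd.continuousOn hH hHpos (show Real.pi - ε < Real.pi by linarith)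
    refine ⟨A, B, hA, hB, fun z _ hz => ?_⟩
    -- The factor exp(iρ Arg z) cancels the phase of z^{-ρ}, leaving |z|^{-ρ}·H(log z).
    have hval : Complex.exp (Complex.I * ρ * z.arg) *
        (H (c * (Complex.log z / c)) * Complex.exp (-(ρ * (c * (Complex.log z / c))))) =
        (Real.exp (-(ρ * (Complex.log z).re)) : ℝ) * H (Complex.log z) := by
      rw [hlogdiv, mul_left_comm, ← Complex.exp_add, mul_comm, Complex.ofReal_exp]
      congr 2
      nth_rw 1 [← Complex.re_add_im (Complex.log z)]
      rw [Complex.log_im]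
      push_cast
      ring
    rw [hval, Complex.re_ofReal_mul]
    exact hAB (Complex.log z) (by rwa [Complex.log_im])
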